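/- Let $(T,\mathcal T)$ be a measurable space and $\mu$ a $\sigma$-finite signed measure on it with total variation measure $|\mu|$. Let $\mathbb L_\mu$ be the space of bounded $\mu$-integrable functions $z:T\to\mathbb R$ with the norm $\|z\|=\bigl(\sup_{t\in T}|z(t)|\bigr)\vee\int_T|z|\,|d\mu|$ and its Borel $\sigma$-field. Let $(X_\alpha)$ be a net, indexed by a nonempty directed set, of arbitrary (not necessarily measurable) maps $X_\alpha:\Omega_\alpha\to\mathbb L_\mu$ defined on probability spaces $(\Omega_\alpha,\mathcal A_\alpha,P_\alpha)$. For arbitrary maps $Z_\alpha:\Omega_\alpha\to\mathbb D$ into a metric space $\mathbb D$, the net $Z_\alpha$ converges weakly to a Borel probability measure $L$ on $\mathbb D$ (or to a Borel measurable random element with law $L$), written $Z_\alpha\leadsto L$, if $E^*f(Z_\alpha)\to\int f\,dL$ for every bounded continuous $f:\mathbb D\to\mathbb R$, where $E^*$ is outer expectation. It is asymptotically tight if for every $\varepsilon>0$ there is a compact $K\subset\mathbb D$ such that $\liminf_\alpha P_*(Z_\alpha\in K^\delta)\ge 1-\varepsilon$ for every $\delta>0$, where $P_*$ is inner probability and $K^\delta=\{y:d(y,K)<\delta\}$.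 1. $X_\alpha$ converges weakly in $\mathbb L_\mu$ to a tight limit if and only if $X_\alpha$ is asymptotically tight and, for every finite subset $\{t_1,\dots,t_k\}$ of $T$, the marginals $(X_\alpha(t_1),\dots,X_\alpha(t_k))$ converge weakly in $\mathbb R^k$ to some Borel probability measure. 2. Let $X=(X(t))_{t\in T}$ be a real stochastic process on a probability space. If $X_\alpha$ is asymptotically tight and for every finite subset $\{t_1,\dots,t_k\}$ of $T$ the marginals $(X_\alpha(t_1),\dots,X_\alpha(t_k))$ converge weakly to $(X(t_1),\dots,X(t_k))$, then there is a version $\tilde X$ of $X$ on the same probability space (that is, $\tilde X(t)=X(t)$ almost surely for every $t\in T$) with all sample paths in $\mathbb L_\mu$, such that $\tilde X$ is a tight Borel measurable map into $\mathbb L_\mu$ and $X_\alpha\leadsto\tilde X$. -/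

import Mathlib

open Filter Topology MeasureTheory
open scoped ENNReal BoundedContinuousFunction

/-- A σ-finite signed measure on `T`, given by its Jordan decomposition `μ = μ⁺ - μ⁻` into two
mutually singular σ-finite measures. By the Hahn-Jordan theorem every σ-finite countably additive
set function with values in `(-∞, ∞]` or in `[-∞, ∞)` is uniquely of this form. The two parts may
also both be infinite, as for the measure `dm` of a `C¹` function `m` on the line. -/
structure SigmaFiniteSignedMeasure (T : Type*) [MeasurableSpace T] where
  posPart : Measure T
  negPart : Measure T
  sigmaFinite_posPart : SigmaFinite posPart
  sigmaFinite_negPart : SigmaFinite negPart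
  mutuallySingular : posPart ⟂ₘ negPart

namespace SigmaFiniteSignedMeasure

/-- The total variation measure `|μ| = μ⁺ + μ⁻`. -/
noncomputable def totalVariation {T : Type*} [MeasurableSpace T]
    (μ : SigmaFiniteSignedMeasure T) : Measure T :=
  μ.posPart + μ.negPart

end SigmaFiniteSignedMeasure

/-- The linear space of all bounded and `μ`-integrable functions `z : T → ℝ`
(functions, not classes of functions modulo null sets). -/
def bddIntegrableSubmodule {T : Type*} [MeasurableSpace T] (μ : SigmaFiniteSignedMeasure T) :
    Submodule ℝ (T → ℝ) where
  carrier := {z | (∃ C : ℝ, ∀ t, |z t| ≤ C) ∧ Integrable z μ.totalVariation}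
  add_mem' := by
    rintro x y ⟨⟨C, hC⟩, hx⟩ ⟨⟨D, hD⟩, hy⟩
    exact ⟨⟨C + D, fun t => (abs_add_le _ _).trans (add_le_add (hC t) (hD t))⟩, hx.add hy⟩
  zero_mem' := ⟨⟨0, fun t => by simp⟩, integrable_zero _ _ _⟩
  smul_mem' := by
    rintro c x ⟨⟨C, hC⟩, hx⟩
    refine ⟨⟨|c| * C, fun t => ?_⟩, hx.smul c⟩
    simpa [abs_mul] using mul_le_mul_of_nonneg_left (hC t) (abs_nonneg c)

/-- The space `𝕃_μ`. It is a type of its own, so that it carries the topology of its norm below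
and not the topology of pointwise convergence. -/
def BddIntegrable {T : Type*} [MeasurableSpace T] (μ : SigmaFiniteSignedMeasure T) : Type _ :=
  ↥(bddIntegrableSubmodule μ)

namespace BddIntegrable

variable {T : Type*} [MeasurableSpace T] {μ : SigmaFiniteSignedMeasure T}

noncomputable instance : AddCommGroup (BddIntegrable μ) :=
  inferInstanceAs (AddCommGroup ↥(bddIntegrableSubmodule μ))

noncomputable instance : Module ℝ (BddIntegrable μ) :=
  inferInstanceAs (Module ℝ ↥(bddIntegrableSubmodule μ))

instance : CoeFun (BddIntegrable μ) (fun _ => T → ℝ) where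
  coe z := z.1

/-- `‖z‖_T = sup_t |z(t)|`. -/
noncomputable def supNorm (z : BddIntegrable μ) : ℝ := ⨆ t, |z t|

/-- `‖z‖_μ = ∫ |z| d|μ|`. -/
noncomputable def integralNorm (z : BddIntegrable μ) : ℝ := ∫ t, |z t| ∂μ.totalVariation

lemma integrable (z : BddIntegrable μ) : Integrable (fun t => z t) μ.totalVariation := z.2.2

lemma abs_le_supNorm (z : BddIntegrable μ) (t : T) : |z t| ≤ supNorm z := by
  obtain ⟨C, hC⟩ := z.2.1
  exact le_ciSup (f := fun t => |z t|) ⟨C, by rintro _ ⟨s, rfl⟩; exact hC s⟩ t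

lemma supNorm_nonneg (z : BddIntegrable μ) : 0 ≤ supNorm z :=
  Real.iSup_nonneg fun _ => abs_nonneg _

lemma supNorm_le (z : BddIntegrable μ) {C : ℝ} (hC : 0 ≤ C) (h : ∀ t, |z t| ≤ C) :
    supNorm z ≤ C :=
  Real.iSup_le h hC

lemma integralNorm_nonneg (z : BddIntegrable μ) : 0 ≤ integralNorm z :=
  integral_nonneg fun _ => abs_nonneg _

/-- The norm `‖z‖ = ‖z‖_T ∨ ‖z‖_μ`. -/
noncomputable def groupNorm : AddGroupNorm (BddIntegrable μ) where
  toFun z := max (supNorm z) (integralNorm z)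
  map_zero' := by
    have h : ∀ t, (0 : BddIntegrable μ) t = 0 := fun _ => rfl
    simp [supNorm, integralNorm, h]
  add_le' x y := by
    have h : ∀ t, (x + y : BddIntegrable μ) t = x t + y t := fun _ => rfl
    refine max_le ?_ ?_
    · refine supNorm_le _ (add_nonneg (le_max_of_le_left (supNorm_nonneg x))
        (le_max_of_le_left (supNorm_nonneg y))) fun t => ?_
      rw [h]
      exact (abs_add_le _ _).trans (add_le_add ((abs_le_supNorm x t).trans (le_max_left _ _))
        ((abs_le_supNorm y t).trans (le_max_left _ _)))
    · refine le_trans ?_ (add_le_add (le_max_right _ _) (le_max_right _ _))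
      unfold integralNorm
      rw [← integral_add x.integrable.abs y.integrable.abs]
      exact integral_mono (x + y).integrable.abs (x.integrable.abs.add y.integrable.abs)
        fun t => by simpa only [h, Pi.add_apply] using abs_add_le (x t) (y t)
  neg' x := by
    have h : ∀ t, (-x : BddIntegrable μ) t = -(x t) := fun _ => rfl
    simp [supNorm, integralNorm, h]
  eq_zero_of_map_eq_zero' x hx := by
    have h0 : supNorm x ≤ 0 := (le_max_left _ _).trans hx.le
    refine Subtype.ext (funext fun t => ?_)
    exact abs_eq_zero.1 (le_antisymm ((abs_le_supNorm x t).trans h0) (abs_nonneg _))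

noncomputable instance : NormedAddCommGroup (BddIntegrable μ) :=
  groupNorm.toNormedAddCommGroup

lemma norm_def (z : BddIntegrable μ) : ‖z‖ = max (supNorm z) (integralNorm z) := rfl

noncomputable instance : NormedSpace ℝ (BddIntegrable μ) where
  norm_smul_le c x := by
    have h : ∀ t, (c • x : BddIntegrable μ) t = c * x t := fun _ => rfl
    rw [norm_def, norm_def, Real.norm_eq_abs]
    refine max_le (supNorm_le _ ?_ fun t => ?_) ?_
    · exact mul_nonneg (abs_nonneg c) (le_max_of_le_left (supNorm_nonneg x))
    · rw [h, abs_mul]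
      exact mul_le_mul_of_nonneg_left ((abs_le_supNorm x t).trans (le_max_left _ _))
        (abs_nonneg c)
    · have h2 : integralNorm (c • x) = |c| * integralNorm x := by
        simp only [integralNorm, h, abs_mul]
        exact integral_const_mul _ _
      rw [h2]
      exact mul_le_mul_of_nonneg_left (le_max_right _ _) (abs_nonneg c)

/-- `𝕃_μ` carries the Borel σ-field of its norm. -/
noncomputable instance : MeasurableSpace (BddIntegrable μ) := borel _

instance : BorelSpace (BddIntegrable μ) := ⟨rfl⟩

end BddIntegrable

/-- The outer expectation `E* Z` of a bounded, possibly nonmeasurable function `Z`: the infimum of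
`E U` over all measurable integrable `U ≥ Z`. -/
noncomputable def outerExpectation {Ω : Type*} [MeasurableSpace Ω] (P : Measure Ω)
    (Z : Ω → ℝ) : ℝ :=
  sInf {r : ℝ | ∃ U : Ω → ℝ, Measurable U ∧ Integrable U P ∧ (∀ ω, Z ω ≤ U ω) ∧ r = ∫ ω, U ω ∂P}

/-- The inner probability `P_*(B)`: the supremum of `P(C)` over all measurable `C ⊆ B`. -/
noncomputable def innerProbability {Ω : Type*} [MeasurableSpace Ω] (P : Measure Ω)
    (B : Set Ω) : ℝ≥0∞ :=
  sSup {p : ℝ≥0∞ | ∃ C : Set Ω, MeasurableSet C ∧ C ⊆ B ∧ p = P C}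

/-- Weak convergence `X_α ⇝ L` of a net of arbitrary maps `X_α : Ω_α → D` to a Borel probability
measure `L` on `D`: `E* f(X_α) → ∫ f dL` for every bounded continuous `f : D → ℝ`. -/
def ConvergesWeakly {A : Type*} [Preorder A] {Ω : A → Type*} [∀ α, MeasurableSpace (Ω α)]
    (P : ∀ α, Measure (Ω α)) {D : Type*} [TopologicalSpace D] [MeasurableSpace D] [BorelSpace D]
    (X : ∀ α, Ω α → D) (L : Measure D) : Prop :=
  IsProbabilityMeasure L ∧
    ∀ f : D →ᵇ ℝ,
      Tendsto (fun α => outerExpectation (P α) (fun ω => f (X α ω))) atTop (𝓝 (∫ x, f x ∂L))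

/-- Asymptotic tightness of a net of arbitrary maps `X_α : Ω_α → D`: for every `ε > 0` there is a
compact `K` with `liminf_α P_*(X_α ∈ K^δ) ≥ 1 - ε` for every `δ > 0`, where `K^δ` is the open
`δ`-enlargement of `K`. -/
def AsymptoticallyTight {A : Type*} [Preorder A] {Ω : A → Type*} [∀ α, MeasurableSpace (Ω α)]
    (P : ∀ α, Measure (Ω α)) {D : Type*} [PseudoMetricSpace D] (X : ∀ α, Ω α → D) : Prop :=
  ∀ ε : ℝ≥0∞, 0 < ε → ∃ K : Set D, IsCompact K ∧
    ∀ δ : ℝ, 0 < δ →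
      1 - ε ≤ liminf (fun α => innerProbability (P α) {ω | X α ω ∈ Metric.thickening δ K}) atTop

/-!
Write `e t z = z t` for the coordinates of `𝕃_μ`. They are continuous, because the norm dominates
the supremum norm, and they separate points. Nothing else about `𝕃_μ` matters, so everything below
is done for a metric space `D` with a point-separating family of continuous functions `e t`.

*Existence of a limit.* Let the net be asymptotically tight with weakly convergent marginals, and
let `f` be bounded and continuous. On a compact set carrying almost all the mass asymptotically,
the Stone-Weierstrass theorem (`exists_cylinder_near`) approximates `f` by a bounded continuous
function of finitely many coordinates; the approximation persists on a neighbourhood of the compact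
set, so `E* f(X_α)` is eventually close to a constant given by a marginal limit, and so is
`-E*(-f(X_α))`. Hence both converge, to the same number `I f`
(`AsymptoticallyTight.exists_tendsto_outerExpectation`). Since outer expectation is sublinear and
`I (-f) = -I f`, the functional `I` is linear; it is positive and tight. To represent it by a
measure (`exists_tight_measure_of_tight_functional`), the Riesz-Markov-Kakutani theorem is applied
on the Stone-Čech compactification of `D`. By tightness the resulting measure is carried by a
σ-compact subset of `D`, on which the inclusion has a Borel left inverse
(`exists_measurable_leftInvOn`), and its image under this inverse is the limit law.

*Necessity.* Marginals converge by the continuous mapping theorem; asymptotic tightness follows by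
testing weak convergence against a continuous function between the indicators of `K` and `K^δ`.

*Versions.* The limit law `L` lives on a σ-compact set, whose points are determined by countably
many coordinates. The process has the finite-dimensional distributions of `L`, hence the same law
on the product space, and applying the measurable reconstruction map to those countably many
coordinates of the process gives the version (`exists_version_of_tight`). Using only countably many
coordinates makes the version measurable without completeness of the probability space.
-/

/-! ### Outer expectation and inner probability -/

section OuterExpectation

variable {Ω : Type*} [MeasurableSpace Ω] {P : Measure Ω} [IsProbabilityMeasure P] {Z W : Ω → ℝ}

lemma outerExpectation_le_integral {C : ℝ} (hC : ∀ ω, C ≤ Z ω) {U : Ω → ℝ} (hU : Measurable U)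
    (hUi : Integrable U P) (hZU : ∀ ω, Z ω ≤ U ω) : outerExpectation P Z ≤ ∫ ω, U ω ∂P := by
  refine csInf_le ⟨C, ?_⟩ ⟨U, hU, hUi, hZU, rfl⟩
  rintro r ⟨V, -, hVi, hZV, rfl⟩
  simpa using integral_mono (integrable_const C) hVi fun ω => (hC ω).trans (hZV ω)

lemma le_outerExpectation {C c : ℝ} (hC : ∀ ω, Z ω ≤ C)
    (h : ∀ U : Ω → ℝ, Measurable U → Integrable U P → (∀ ω, Z ω ≤ U ω) → c ≤ ∫ ω, U ω ∂P) :
    c ≤ outerExpectation P Z := by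
  refine le_csInf ⟨_, fun _ => C, measurable_const, integrable_const C, hC, rfl⟩ ?_
  rintro r ⟨U, hU, hUi, hZU, rfl⟩
  exact h U hU hUi hZU

lemma outerExpectation_const (c : ℝ) : outerExpectation P (fun _ => c) = c := by
  refine le_antisymm ?_ ?_
  · simpa using outerExpectation_le_integral (P := P) (fun _ : Ω => le_refl c) measurable_const
      (integrable_const c) (fun _ => le_refl c)
  · refine le_outerExpectation (fun _ => le_refl c) fun U _ hUi hU => ?_
    simpa using integral_mono (integrable_const c) hUi hU

lemma outerExpectation_mono (hZ : ∃ C, ∀ ω, |Z ω| ≤ C) (hW : ∃ C, ∀ ω, |W ω| ≤ C)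
    (h : ∀ ω, Z ω ≤ W ω) : outerExpectation P Z ≤ outerExpectation P W := by
  obtain ⟨C, hC⟩ := hZ
  obtain ⟨D, hD⟩ := hW
  exact le_outerExpectation (fun ω => (abs_le.1 (hD ω)).2) fun U hU hUi hWU =>
    outerExpectation_le_integral (fun ω => (abs_le.1 (hC ω)).1) hU hUi
      fun ω => (h ω).trans (hWU ω)

lemma outerExpectation_add_le (hZ : ∃ C, ∀ ω, |Z ω| ≤ C) (hW : ∃ C, ∀ ω, |W ω| ≤ C) :
    outerExpectation P (fun ω => Z ω + W ω) ≤ outerExpectation P Z + outerExpectation P W := by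
  obtain ⟨C, hC⟩ := hZ
  obtain ⟨D, hD⟩ := hW
  rw [← sub_le_iff_le_add]
  refine le_outerExpectation (fun ω => (abs_le.1 (hC ω)).2) fun U hU hUi hZU => ?_
  rw [sub_le_comm]
  refine le_outerExpectation (fun ω => (abs_le.1 (hD ω)).2) fun V hV hVi hWV => ?_
  rw [sub_le_iff_le_add', ← integral_add hUi hVi]
  exact outerExpectation_le_integral
    (fun ω => add_le_add (abs_le.1 (hC ω)).1 (abs_le.1 (hD ω)).1)
    (hU.add hV) (hUi.add hVi) fun ω => add_le_add (hZU ω) (hWV ω)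

lemma outerExpectation_const_mul_le (hZ : ∃ C, ∀ ω, |Z ω| ≤ C) {c : ℝ} (hc : 0 < c) :
    outerExpectation P (fun ω => c * Z ω) ≤ c * outerExpectation P Z := by
  obtain ⟨C, hC⟩ := hZ
  rw [mul_comm c (outerExpectation P Z), ← div_le_iff₀ hc]
  refine le_outerExpectation (fun ω => (abs_le.1 (hC ω)).2) fun U hU hUi hZU => ?_
  rw [div_le_iff₀ hc, mul_comm, ← integral_const_mul]
  exact outerExpectation_le_integral
    (fun ω => mul_le_mul_of_nonneg_left (abs_le.1 (hC ω)).1 hc.le)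
    (hU.const_mul c) (hUi.const_mul c) fun ω => mul_le_mul_of_nonneg_left (hZU ω) hc.le

/-- If `Z ≤ W` on an event of large inner probability, and `Z ≤ W + B` elsewhere, then
`E* Z` exceeds `E* W` only by little. -/
lemma outerExpectation_le_add_of_innerProbability (hZ : ∃ C, ∀ ω, |Z ω| ≤ C)
    (hW : ∃ C, ∀ ω, |W ω| ≤ C) {S : Set Ω} (hS : ∀ ω ∈ S, Z ω ≤ W ω) {B : ℝ} (hB : 0 ≤ B)
    (hZW : ∀ ω, Z ω ≤ W ω + B) {ε : ℝ} (hP : ENNReal.ofReal (1 - ε) < innerProbability P S) :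
    outerExpectation P Z ≤ outerExpectation P W + B * ε := by
  obtain ⟨C, hC⟩ := hZ
  obtain ⟨D, hD⟩ := hW
  obtain ⟨_, ⟨E, hE, hES, rfl⟩, hPE⟩ := lt_sSup_iff.1 hP
  have hEc : P.real Eᶜ ≤ ε := by
    have h1 : 1 - ε < P.real E := by
      by_contra! h
      exact absurd hPE (not_lt.2 (by simpa using ENNReal.ofReal_le_ofReal h))
    rw [probReal_compl_eq_one_sub hE]
    linarith
  rw [← sub_le_iff_le_add]
  refine le_outerExpectation (fun ω => (abs_le.1 (hD ω)).2) fun U hU hUi hWU => ?_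
  rw [sub_le_iff_le_add]
  have hind : Integrable (Eᶜ.indicator fun _ => B) P := (integrable_const B).indicator hE.compl
  refine (outerExpectation_le_integral (fun ω => (abs_le.1 (hC ω)).1)
    (hU.add (measurable_const.indicator hE.compl)) (hUi.add hind) fun ω => ?_).trans ?_
  · by_cases hω : ω ∈ E
    · simpa [hω] using (hS ω (hES hω)).trans (hWU ω)
    · simpa [hω] using (hZW ω).trans (by gcongr; exact hWU ω)
  · simp only [Pi.add_apply]
    rw [integral_add hUi hind, integral_indicator_const B hE.compl, smul_eq_mul, mul_comm]
    gcongr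

/-- The inner expectation `E_* Z = -E*(-Z)` of a function `Z ≤ 1` that is nonpositive outside `S`
bounds the inner probability of `S` from below. -/
lemma ofReal_neg_outerExpectation_neg_le_innerProbability (hZ : ∃ C, ∀ ω, |Z ω| ≤ C)
    (hZ1 : ∀ ω, Z ω ≤ 1) {S : Set Ω} (hS : ∀ ω, ω ∉ S → Z ω ≤ 0) :
    ENNReal.ofReal (-outerExpectation P (fun ω => -Z ω)) ≤ innerProbability P S := by
  obtain ⟨C, hC⟩ := hZ
  refine ENNReal.le_of_forall_pos_le_add fun ε hε _ => ?_
  -- for `c > E*(-Z)` some measurable `U ≥ -Z` has `∫ U < c`, and `{U < 0} ⊆ S` has measure `≥ -c`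
  have key : ∀ c : ℝ, outerExpectation P (fun ω => -Z ω) < c →
      ENNReal.ofReal (-c) ≤ innerProbability P S := by
    intro c hc
    by_contra hcon
    refine absurd hc (not_lt.2 (le_outerExpectation
      (fun ω => neg_le.1 (abs_le.1 (hC ω)).1) fun U hU hUi hZU => ?_))
    by_contra hlt
    refine hcon ?_
    let E : Set Ω := {ω | U ω < 0}
    have hE : MeasurableSet E := measurableSet_lt hU measurable_const
    have hES : E ⊆ S := fun ω hω => by
      by_contra hωS
      have h1 := hS ω hωS
      have h2 := hZU ω
      have h3 : U ω < 0 := hω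
      linarith
    refine le_trans ?_ (le_sSup ⟨E, hE, hES, rfl⟩)
    refine ENNReal.ofReal_le_of_le_toReal ?_
    have h1 : ∫ ω, E.indicator (fun _ => (-1 : ℝ)) ω ∂P ≤ ∫ ω, U ω ∂P := by
      refine integral_mono ((integrable_const _).indicator hE) hUi fun ω => ?_
      by_cases hω : ω ∈ E
      · simpa [hω] using (neg_le_neg (hZ1 ω)).trans (hZU ω)
      · simpa [hω] using (not_lt.1 hω : 0 ≤ U ω)
    rw [integral_indicator_const _ hE, smul_eq_mul] at h1
    change -c ≤ P.real E
    linarith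
  have h := key (outerExpectation P (fun ω => -Z ω) + ε)
    (lt_add_of_pos_right _ (NNReal.coe_pos.2 hε))
  calc ENNReal.ofReal (-outerExpectation P (fun ω => -Z ω))
      = ENNReal.ofReal (-(outerExpectation P (fun ω => -Z ω) + ε) + ε) := by congr 1; ring
    _ ≤ ENNReal.ofReal (-(outerExpectation P (fun ω => -Z ω) + ε)) + ENNReal.ofReal ε :=
        ENNReal.ofReal_add_le
    _ ≤ innerProbability P S + ε := by gcongr; simp

end OuterExpectation

/-! ### Measurable inverses on σ-compact sets -/

/-- An injective continuous map on a σ-compact set has a Borel measurable left inverse: the image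
of a closed subset is again σ-compact, hence Borel. -/
lemma exists_measurable_leftInvOn {D E : Type*} [TopologicalSpace D]
    [MeasurableSpace D] [BorelSpace D] [Nonempty D] [TopologicalSpace E] [T2Space E]
    [MeasurableSpace E] [OpensMeasurableSpace E] {K : ℕ → Set D} (hK : ∀ n, IsCompact (K n))
    {π : D → E} (hπ : Continuous π) (hinj : Set.InjOn π (⋃ n, K n)) :
    ∃ r : E → D, Measurable r ∧ Set.LeftInvOn r π (⋃ n, K n) := by
  classical
  set S := ⋃ n, K n with hS
  obtain ⟨d⟩ := ‹Nonempty D›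
  have hmeas : ∀ C : Set D, IsClosed C → MeasurableSet (π '' (S ∩ C)) := by
    intro C hC
    rw [hS, Set.iUnion_inter, Set.image_iUnion]
    exact MeasurableSet.iUnion fun n => (((hK n).inter_right hC).image hπ).measurableSet
  let r : E → D := fun z => if h : ∃ x ∈ S, π x = z then h.choose else d
  have hr : Set.LeftInvOn r π S := by
    intro x hx
    have h : ∃ y ∈ S, π y = π x := ⟨x, hx, rfl⟩
    have : r (π x) = h.choose := dif_pos h
    rw [this]
    exact hinj h.choose_spec.1 hx h.choose_spec.2
  refine ⟨r, measurable_of_isClosed fun C hC => ?_, hr⟩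
  have hout : ∀ z, z ∉ π '' S → r z = d := fun z hz => dif_neg hz
  have hSm : MeasurableSet (π '' S) := by simpa using hmeas Set.univ isClosed_univ
  have hpre : r ⁻¹' C = π '' (S ∩ C) ∪ ((π '' S)ᶜ ∩ {_z | d ∈ C}) := by
    ext z
    by_cases hz : z ∈ π '' S
    · obtain ⟨x, hx, rfl⟩ := hz
      have hxS : π x ∈ π '' S := ⟨x, hx, rfl⟩
      have hiff : π x ∈ π '' (S ∩ C) ↔ x ∈ C :=
        ⟨fun ⟨y, hy, hyx⟩ => hinj hy.1 hx hyx ▸ hy.2, fun h => ⟨x, ⟨hx, h⟩, rfl⟩⟩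
      simp only [Set.mem_preimage, hr hx, Set.mem_union, hiff, Set.mem_inter_iff,
        Set.mem_compl_iff, hxS, not_true, false_and, or_false]
    · have hzC : z ∉ π '' (S ∩ C) := fun h => hz (Set.image_mono Set.inter_subset_left h)
      simp only [Set.mem_preimage, hout z hz, Set.mem_union, hzC, Set.mem_inter_iff,
        Set.mem_compl_iff, hz, not_false_eq_true, true_and, false_or, Set.mem_ofPred_eq]
  rw [hpre]
  exact (hmeas C hC).union (hSm.compl.inter (MeasurableSet.const _))

/-- Countably many members of a family of continuous functions that separates points already
separate the points of a σ-compact set. -/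
lemma exists_countable_injOn_iUnion_isCompact {D ι : Type*} [MetricSpace D]
    {e : ι → D → ℝ} (he : ∀ t, Continuous (e t))
    (hsep : ∀ x y, (∀ t, e t x = e t y) → x = y) {K : ℕ → Set D} (hK : ∀ n, IsCompact (K n)) :
    ∃ J : Set ι, J.Countable ∧
      Set.InjOn (fun (x : D) (t : J) => e t x) (⋃ n, K n) := by
  set S := ⋃ n, K n
  have hS : TopologicalSpace.IsSeparable S := .iUnion fun n => (hK n).isSeparable
  have : SecondCountableTopology S := hS.secondCountableTopology
  obtain ⟨J, hJ, hJU⟩ := TopologicalSpace.isOpen_iUnion_countable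
    (fun t => {p : S × S | e t p.1 ≠ e t p.2}) fun t =>
      isOpen_ne_fun ((he t).comp (by fun_prop)) ((he t).comp (by fun_prop))
  refine ⟨J, hJ, fun x hx y hy hxy => hsep x y fun t => ?_⟩
  by_contra hne
  have hmem : ((⟨x, hx⟩, ⟨y, hy⟩) : S × S) ∈ ⋃ t, {p : S × S | e t p.1 ≠ e t p.2} :=
    Set.mem_iUnion.2 ⟨t, hne⟩
  rw [← hJU] at hmem
  obtain ⟨s, hs, h⟩ := Set.mem_iUnion₂.1 hmem
  exact h (congrFun hxy ⟨s, hs⟩)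

/-! ### Tight positive functionals are integrals -/

/-- A bounded continuous real function extends to the Stone-Čech compactification. -/
lemma exists_continuousMap_stoneCech_extension {D : Type*} [TopologicalSpace D] (f : D →ᵇ ℝ) :
    ∃ h : C(StoneCech D, ℝ), ∀ x, h (stoneCechUnit x) = f x := by
  let g : D → Set.Icc (-‖f‖) ‖f‖ := fun x => ⟨f x, abs_le.1 (f.norm_coe_le_norm x)⟩
  have hg : Continuous g := f.continuous.subtype_mk _
  refine ⟨⟨fun z => (stoneCechExtend hg z).1,
    continuous_subtype_val.comp (continuous_stoneCechExtend hg)⟩, fun x => ?_⟩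
  change (stoneCechExtend hg (stoneCechUnit x)).1 = f x
  rw [stoneCechExtend_stoneCechUnit]

open scoped CompactlySupported in
/-- A positive normalized linear functional on the bounded continuous functions of a metric space
that is tight is the integral against a tight Borel probability measure. The functional is
represented by a measure on the Stone-Čech compactification, and tightness says that this measure
lives on a σ-compact subset of the original space, from which it is pulled back. -/
theorem exists_tight_measure_of_tight_functional {D : Type*} [MetricSpace D] [MeasurableSpace D]
    [BorelSpace D] (I : (D →ᵇ ℝ) →ₗ[ℝ] ℝ) (hpos : ∀ f : D →ᵇ ℝ, (∀ x, 0 ≤ f x) → 0 ≤ I f)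
    (hone : I (.const D 1) = 1)
    (htight : ∀ ε : ℝ, 0 < ε → ∃ K : Set D, IsCompact K ∧
      ∀ f : D →ᵇ ℝ, (∀ x, 0 ≤ f x) → (∀ x ∈ K, 1 ≤ f x) → 1 - ε ≤ I f) :
    ∃ L : Measure D, IsProbabilityMeasure L ∧ IsTightMeasureSet {L} ∧
      ∀ f : D →ᵇ ℝ, ∫ x, f x ∂L = I f := by
  have hne : Nonempty D := by
    by_contra hD
    rw [not_nonempty_iff] at hD
    rw [show BoundedContinuousFunction.const D (1 : ℝ) = 0 from
      BoundedContinuousFunction.ext fun x => (hD.false x).elim, map_zero] at hone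
    exact zero_ne_one hone
  let ι : C(D, StoneCech D) := ⟨stoneCechUnit, continuous_stoneCechUnit⟩
  have hι : Function.Injective ι := injective_stoneCechUnit_of_t35Space
  let _ : MeasurableSpace (StoneCech D) := borel _
  have : BorelSpace (StoneCech D) := ⟨rfl⟩
  let Λ : C_c(StoneCech D, ℝ) →ₚ[ℝ] ℝ :=
    { toFun := fun h =>
        I ((BoundedContinuousFunction.mkOfCompact h.toContinuousMap).compContinuous ι)
      map_add' := fun h k => by rw [← map_add]; rfl
      map_smul' := fun c h => by rw [RingHom.id_apply, ← map_smul]; rfl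
      monotone' := fun h k hhk => by
        rw [← sub_nonneg, ← map_sub]
        exact hpos _ fun x => sub_nonneg.2 (hhk (ι x)) }
  set ν := RealRMK.rieszMeasure Λ
  have hint : ∀ (h : C(StoneCech D, ℝ)) (f : D →ᵇ ℝ), (∀ x, h (ι x) = f x) →
      ∫ z, h z ∂ν = I f := by
    intro h f hf
    have := RealRMK.integral_rieszMeasure Λ ⟨h, HasCompactSupport.of_compactSpace _⟩
    refine this.trans (congrArg I ?_)
    ext x
    exact hf x
  have hνP : IsProbabilityMeasure ν := by
    have h := hint (.const _ 1) (.const D 1) fun _ => rfl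
    rw [hone] at h
    exact ⟨(ENNReal.toReal_eq_one_iff _).1 (by simpa [measureReal_def] using h)⟩
  choose K hK hKI using fun n : ℕ => htight (1 / ((n : ℝ) + 1)) Nat.one_div_pos_of_nat
  have hιK : ∀ n, IsCompact (ι '' K n) := fun n => (hK n).image ι.continuous
  -- outer regularity and Urysohn functions turn tightness of `I` into a bound for `ν`
  have hνK : ∀ n : ℕ, ν (ι '' K n)ᶜ ≤ ENNReal.ofReal (1 / ((n : ℝ) + 1)) := by
    intro n
    have hle : ENNReal.ofReal (1 - 1 / ((n : ℝ) + 1)) ≤ ν (ι '' K n) := by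
      rw [Set.measure_eq_iInf_isOpen]
      refine le_iInf₂ fun U hKU => le_iInf fun hU => ?_
      obtain ⟨h, h0, h1, h01⟩ := exists_continuous_zero_one_of_isClosed hU.isClosed_compl
        (hιK n).isClosed (Set.disjoint_compl_left_iff_subset.2 hKU)
      refine ENNReal.ofReal_le_of_le_toReal ?_
      calc 1 - 1 / ((n : ℝ) + 1)
          ≤ I ((BoundedContinuousFunction.mkOfCompact h).compContinuous ι) :=
            hKI n _ (fun x => (h01 _).1) fun x hx => (h1 ⟨x, hx, rfl⟩).ge
        _ = ∫ z, h z ∂ν := (hint h _ fun _ => rfl).symm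
        _ ≤ ∫ z, U.indicator (fun _ => (1 : ℝ)) z ∂ν := by
            refine integral_mono
              (h.continuous.integrable_of_hasCompactSupport (HasCompactSupport.of_compactSpace _))
              ((integrable_const _).indicator hU.measurableSet) fun z => ?_
            by_cases hz : z ∈ U
            · simpa [hz] using (h01 z).2
            · simpa [hz] using (h0 hz).le
        _ = ν.real U := by simp [integral_indicator_const _ hU.measurableSet]
    rw [prob_compl_eq_one_sub (hιK n).measurableSet, tsub_le_iff_right]
    calc (1 : ℝ≥0∞) = ENNReal.ofReal (1 / ((n : ℝ) + 1) + (1 - 1 / ((n : ℝ) + 1))) := by simp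
      _ ≤ ENNReal.ofReal (1 / ((n : ℝ) + 1)) + ENNReal.ofReal (1 - 1 / ((n : ℝ) + 1)) :=
          ENNReal.ofReal_add_le
      _ ≤ _ := by gcongr
  obtain ⟨r, hr, hrι⟩ := exists_measurable_leftInvOn hK ι.continuous hι.injOn
  have hlim : Tendsto (fun n : ℕ => ENNReal.ofReal (1 / ((n : ℝ) + 1))) atTop (𝓝 0) := by
    simpa using ENNReal.tendsto_ofReal tendsto_one_div_add_atTop_nhds_zero_nat
  have hae : ∀ᵐ z ∂ν, z ∈ ι '' ⋃ n, K n := by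
    refine le_antisymm (ge_of_tendsto' hlim fun n => (measure_mono ?_).trans (hνK n)) zero_le
    exact Set.compl_subset_compl.2 (Set.image_mono (Set.subset_iUnion K n))
  refine ⟨ν.map r, Measure.isProbabilityMeasure_map hr.aemeasurable, ?_, fun f => ?_⟩
  · rw [isTightMeasureSet_iff_exists_isCompact_measure_compl_le]
    intro ε hε
    obtain ⟨n, hn⟩ := (hlim.eventually_lt_const hε).exists
    refine ⟨K n, hK n, ?_⟩
    rintro _ rfl
    rw [Measure.map_apply hr (hK n).measurableSet.compl]
    refine ((measure_mono ?_).trans (hνK n)).trans hn.le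
    rintro z hz ⟨x, hx, rfl⟩
    exact hz (by rwa [hrι (Set.mem_iUnion.2 ⟨n, hx⟩)])
  · obtain ⟨h, hh⟩ := exists_continuousMap_stoneCech_extension f
    rw [integral_map hr.aemeasurable f.continuous.measurable.aestronglyMeasurable,
      ← hint h f hh]
    refine integral_congr_ae (hae.mono ?_)
    rintro _ ⟨x, hx, rfl⟩
    exact (congrArg f (hrι hx)).trans (hh x).symm

/-! ### Cylinder functions are dense on compact sets -/

/-- By the Stone-Weierstrass theorem, a bounded continuous function is approximated uniformly on a
compact set by bounded continuous functions of finitely many coordinates, with the same bound. -/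
lemma exists_cylinder_near {D ι : Type*} [TopologicalSpace D] {e : ι → D → ℝ}
    (he : ∀ t, Continuous (e t)) (hsep : ∀ x y, (∀ t, e t x = e t y) → x = y)
    (f : D →ᵇ ℝ) {K : Set D} (hK : IsCompact K) {η : ℝ} (hη : 0 < η) :
    ∃ (s : Finset ι) (φ : (s → ℝ) →ᵇ ℝ), (∀ z, |φ z| ≤ ‖f‖) ∧
      ∀ x ∈ K, |φ (fun t : s => e t x) - f x| < η := by
  classical
  let 𝓐 : Subalgebra ℝ C(D, ℝ) := Algebra.adjoin ℝ (Set.range fun t => ⟨e t, he t⟩)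
  have h𝓐 : 𝓐.SeparatesPoints := by
    intro x y hxy
    by_contra! hcon
    exact hxy (hsep x y fun t => hcon _ ⟨⟨e t, he t⟩, Algebra.subset_adjoin ⟨t, rfl⟩, rfl⟩)
  have hcyl : ∀ g ∈ 𝓐, ∃ (s : Finset ι) (φ : C(s → ℝ, ℝ)), ∀ x, g x = φ (fun t : s => e t x) := by
    -- a function of the coordinates in `s` is one of the coordinates in any larger set
    have henl : ∀ {s s' : Finset ι} (h : s ⊆ s') (φ : C(s → ℝ, ℝ)), ∃ ψ : C(s' → ℝ, ℝ),
        ∀ x, φ (fun t : s => e t x) = ψ (fun t : s' => e t x) := fun {s s'} h φ =>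
      ⟨⟨fun z => φ fun t => z ⟨t, h t.2⟩, by fun_prop⟩, fun _ => rfl⟩
    intro g hg
    induction hg using Algebra.adjoin_induction with
    | mem g hg =>
      obtain ⟨t, rfl⟩ := hg
      exact ⟨{t}, ⟨fun z => z ⟨t, Finset.mem_singleton_self t⟩, by fun_prop⟩, fun _ => rfl⟩
    | algebraMap c => exact ⟨∅, .const _ c, fun _ => rfl⟩
    | add g k _ _ hg hk =>
      obtain ⟨s, φ, hφ⟩ := hg
      obtain ⟨s', ψ, hψ⟩ := hk
      obtain ⟨φ', hφ'⟩ := henl Finset.subset_union_left φ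
      obtain ⟨ψ', hψ'⟩ := henl Finset.subset_union_right ψ
      exact ⟨s ∪ s', φ' + ψ', fun x => by simp [hφ, hψ, hφ', hψ']⟩
    | mul g k _ _ hg hk =>
      obtain ⟨s, φ, hφ⟩ := hg
      obtain ⟨s', ψ, hψ⟩ := hk
      obtain ⟨φ', hφ'⟩ := henl Finset.subset_union_left φ
      obtain ⟨ψ', hψ'⟩ := henl Finset.subset_union_right ψ
      exact ⟨s ∪ s', φ' * ψ', fun x => by simp [hφ, hψ, hφ', hψ']⟩
  obtain ⟨g, hg, hgf⟩ :=
    ContinuousMap.exists_mem_subalgebra_near_continuous_of_isCompact_of_separatesPoints h𝓐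
      f.toContinuousMap hK hη
  obtain ⟨s, φ, hφ⟩ := hcyl g hg
  -- truncation at `±‖f‖` makes `φ` bounded and only brings it closer to `f`
  have hbd : ∀ z, |max (-‖f‖) (min ‖f‖ (φ z))| ≤ ‖f‖ := fun z =>
    abs_le.2 ⟨le_max_left _ _,
      max_le (neg_le_self (norm_nonneg f)) (min_le_left _ _)⟩
  refine ⟨s, .ofNormedAddCommGroup (fun z => max (-‖f‖) (min ‖f‖ (φ z))) (by fun_prop) ‖f‖ hbd,
    hbd, fun x hx => ?_⟩
  have h1 := hgf x hx
  rw [hφ, Real.norm_eq_abs, abs_lt] at h1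
  have h2 := abs_le.1 (f.norm_coe_le_norm x)
  change -η < φ _ - f x ∧ φ _ - f x < η at h1
  change |max (-‖f‖) (min ‖f‖ (φ _)) - f x| < η
  rw [abs_lt]
  constructor
  · rw [neg_lt_sub_iff_lt_add, ← sub_lt_iff_lt_add']
    refine lt_max_of_lt_right (lt_min ?_ ?_) <;> linarith
  · rw [sub_lt_iff_lt_add]
    refine max_lt ?_ (min_lt_of_right_lt ?_) <;> linarith

/-! ### Asymptotic tightness and weak convergence of nets -/

/-- A net that is eventually within every `ε` of some constant converges; a second net that is
eventually close to the opposite constants converges to the opposite limit. -/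
lemma exists_tendsto_of_eventually_near {A : Type*} {l : Filter A} [l.NeBot] {u v : A → ℝ}
    (h : ∀ ε : ℝ, 0 < ε → ∃ c : ℝ, ∀ᶠ α in l, |u α - c| ≤ ε ∧ |v α + c| ≤ ε) :
    ∃ a : ℝ, Tendsto u l (𝓝 a) ∧ Tendsto v l (𝓝 (-a)) := by
  have hu : Cauchy (map u l) := by
    refine Metric.cauchy_iff.2 ⟨inferInstance, fun ε hε => ?_⟩
    obtain ⟨c, hc⟩ := h (ε / 3) (by positivity)
    refine ⟨Metric.closedBall c (ε / 3), hc.mono fun α hα => hα.1, fun x hx y hy => ?_⟩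
    have := dist_triangle_right x y c
    rw [Metric.mem_closedBall] at hx hy
    linarith
  obtain ⟨a, ha⟩ := cauchy_map_iff_exists_tendsto.1 hu
  have huv : Tendsto (fun α => u α + v α) l (𝓝 0) := by
    refine Metric.tendsto_nhds.2 fun ε hε => ?_
    obtain ⟨c, hc⟩ := h (ε / 3) (by positivity)
    refine hc.mono fun α hα => ?_
    rw [Real.dist_eq, sub_zero]
    have := abs_add_le (u α - c) (v α + c)
    rw [show u α - c + (v α + c) = u α + v α by ring] at this
    linarith [hα.1, hα.2]
  exact ⟨a, ha, by simpa using huv.sub ha⟩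

section Nets

variable {A : Type*} [Preorder A] {Ω : A → Type*} [∀ α, MeasurableSpace (Ω α)]
  {P : ∀ α, Measure (Ω α)}

lemma BoundedContinuousFunction.exists_abs_comp_le {D Ω' : Type*} [TopologicalSpace D]
    (f : D →ᵇ ℝ) (X : Ω' → D) : ∃ C, ∀ ω, |f (X ω)| ≤ C :=
  ⟨‖f‖, fun _ => f.norm_coe_le_norm _⟩

/-- Under asymptotic tightness, inequalities on a large compact set carry over asymptotically to
outer expectations, since they persist on a neighbourhood of the compact set. -/
lemma AsymptoticallyTight.exists_isCompact_eventually_le [∀ α, IsProbabilityMeasure (P α)]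
    {D : Type*} [PseudoMetricSpace D]
    {X : ∀ α, Ω α → D} (h : AsymptoticallyTight P X) {ε : ℝ} (hε : 0 < ε) :
    ∃ K : Set D, IsCompact K ∧ ∀ (f g : D →ᵇ ℝ) (η B : ℝ), 0 ≤ η → 0 ≤ B →
      (∀ x ∈ K, f x < g x + η) → (∀ x, f x ≤ g x + B) →
      ∀ᶠ α in atTop, outerExpectation (P α) (fun ω => f (X α ω)) ≤
        outerExpectation (P α) (fun ω => g (X α ω)) + η + B * ε := by
  -- truncated at `1`, so that `1 - ε' < 1 - ε' / 2` stays strict in `ℝ≥0∞`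
  set ε' := min ε 1
  have hε'0 : 0 < ε' := lt_min hε one_pos
  obtain ⟨K, hK, hKδ⟩ := h (ENNReal.ofReal (ε' / 2)) (by simpa using hε'0)
  refine ⟨K, hK, fun f g η B hη hB hfg hfgB => ?_⟩
  obtain ⟨δ, hδ, hδK⟩ := hK.exists_thickening_subset_open
    (isOpen_lt f.continuous (g.continuous.add continuous_const)) hfg
  have hlt : ENNReal.ofReal (1 - ε') < 1 - ENNReal.ofReal (ε' / 2) := by
    rw [← ENNReal.ofReal_one, ← ENNReal.ofReal_sub _ (by positivity)]
    have : ε' ≤ 1 := min_le_right _ _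
    exact (ENNReal.ofReal_lt_ofReal_iff (by linarith)).2 (by linarith)
  refine (eventually_lt_of_lt_liminf (hlt.trans_le (hKδ δ hδ))).mono fun α hα => ?_
  have hg := g.exists_abs_comp_le (X α)
  have hc : ∃ C, ∀ _ : Ω α, |η| ≤ C := ⟨|η|, fun _ => le_rfl⟩
  have h1 := outerExpectation_add_le (P := P α) hg hc
  rw [outerExpectation_const] at h1
  have h2 := outerExpectation_le_add_of_innerProbability (f.exists_abs_comp_le (X α))
    (W := fun ω => g (X α ω) + η) ((g + .const D η).exists_abs_comp_le (X α))
    (fun ω hω => (show f (X α ω) < g (X α ω) + η from hδK hω).le) hB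
    (fun ω => (hfgB (X α ω)).trans (by linarith)) hα
  have h3 : B * ε' ≤ B * ε := by gcongr; exact min_le_left _ _
  linarith

/-- An asymptotically tight net whose finite-dimensional marginals with respect to a separating
family of continuous coordinates converge weakly is asymptotically measurable, and its outer
expectations converge. -/
lemma AsymptoticallyTight.exists_tendsto_outerExpectation [IsDirectedOrder A] [Nonempty A]
    [∀ α, IsProbabilityMeasure (P α)] {D ι : Type*} [PseudoMetricSpace D] {e : ι → D → ℝ}
    (he : ∀ t, Continuous (e t)) (hsep : ∀ x y, (∀ t, e t x = e t y) → x = y)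
    {X : ∀ α, Ω α → D} (h : AsymptoticallyTight P X)
    (hmarg : ∀ s : Finset ι, ∃ M : Measure (s → ℝ),
      ConvergesWeakly P (fun α ω (t : s) => e t (X α ω)) M) (f : D →ᵇ ℝ) :
    ∃ a : ℝ, Tendsto (fun α => outerExpectation (P α) (fun ω => f (X α ω))) atTop (𝓝 a) ∧
      Tendsto (fun α => outerExpectation (P α) (fun ω => -f (X α ω))) atTop (𝓝 (-a)) := by
  refine exists_tendsto_of_eventually_near fun δ hδ => ?_
  have hf0 := norm_nonneg f
  -- replacing `f` by its approximant costs `ε + 2‖f‖ε`, and the marginal limit another `ε`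
  set ε := δ / (2 + 2 * ‖f‖) with hεdef
  have hε : 0 < ε := by positivity
  have hεδ : ε + ε + 2 * ‖f‖ * ε = δ := by rw [hεdef]; field_simp; ring
  obtain ⟨K, hK, hKle⟩ := h.exists_isCompact_eventually_le hε
  obtain ⟨s, φ, hφf, hφK⟩ := exists_cylinder_near he hsep f hK hε
  obtain ⟨M, -, hM⟩ := hmarg s
  let g : D →ᵇ ℝ := φ.compContinuous ⟨fun x (t : s) => e t x, by fun_prop⟩
  have hgf : ∀ x ∈ K, |g x - f x| < ε := hφK
  have hg : ∀ x, |g x| ≤ ‖f‖ := fun x => hφf _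
  have hf : ∀ x, |f x| ≤ ‖f‖ := fun x => f.norm_coe_le_norm x
  have hB : 0 ≤ 2 * ‖f‖ := by positivity
  have hMneg := hM (-φ)
  simp only [BoundedContinuousFunction.coe_neg, Pi.neg_apply, integral_neg] at hMneg
  refine ⟨∫ z, φ z ∂M, ?_⟩
  have hnear : ∀ k₁ k₂ : D →ᵇ ℝ, (∀ x ∈ K, |k₁ x - k₂ x| < ε) → (∀ x, |k₁ x| ≤ ‖f‖) →
      (∀ x, |k₂ x| ≤ ‖f‖) → ∀ᶠ α in atTop, outerExpectation (P α) (fun ω => k₁ (X α ω)) ≤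
        outerExpectation (P α) (fun ω => k₂ (X α ω)) + ε + 2 * ‖f‖ * ε := by
    intro k₁ k₂ hk h1 h2
    refine hKle k₁ k₂ ε (2 * ‖f‖) hε.le hB (fun x hx => ?_) fun x => ?_
    · linarith [(abs_lt.1 (hk x hx)).2]
    · linarith [(abs_le.1 (h1 x)).2, (abs_le.1 (h2 x)).1]
  filter_upwards [hnear f g (fun x hx => by rw [abs_sub_comm]; exact hgf x hx) hf hg,
    hnear g f hgf hg hf,
    hnear (-f) (-g) (fun x hx => by simpa [add_comm, sub_eq_add_neg] using hgf x hx)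
      (by simpa using hf) (by simpa using hg),
    hnear (-g) (-f) (fun x hx => by
      rw [abs_sub_comm]; simpa [add_comm, sub_eq_add_neg] using hgf x hx)
      (by simpa using hg) (by simpa using hf),
    (hM φ).eventually (Metric.closedBall_mem_nhds _ hε),
    hMneg.eventually (Metric.closedBall_mem_nhds _ hε)] with α h1 h2 h3 h4 h5 h6
  simp only [BoundedContinuousFunction.coe_neg, Pi.neg_apply] at h3 h4
  change |outerExpectation (P α) (fun ω => g (X α ω)) - _| ≤ ε at h5
  change |outerExpectation (P α) (fun ω => -g (X α ω)) - _| ≤ ε at h6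
  rw [abs_le] at h5 h6 ⊢
  rw [abs_le]
  refine ⟨⟨?_, ?_⟩, ?_, ?_⟩ <;> linarith

end Nets

/-! ### Weak limits of nets -/

section Limits

variable {A : Type*} [Preorder A] {Ω : A → Type*} [∀ α, MeasurableSpace (Ω α)]
  {P : ∀ α, Measure (Ω α)} {D : Type*} [MetricSpace D] [MeasurableSpace D] [BorelSpace D]
  {X : ∀ α, Ω α → D}

/-- The limit of the outer expectations of an asymptotically tight net with convergent marginals is
a tight positive linear functional, hence a tight weak limit. -/
theorem AsymptoticallyTight.exists_convergesWeakly [IsDirectedOrder A] [Nonempty A]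
    [∀ α, IsProbabilityMeasure (P α)] {ι : Type*} {e : ι → D → ℝ}
    (he : ∀ t, Continuous (e t)) (hsep : ∀ x y, (∀ t, e t x = e t y) → x = y)
    (h : AsymptoticallyTight P X)
    (hmarg : ∀ s : Finset ι, ∃ M : Measure (s → ℝ),
      ConvergesWeakly P (fun α ω (t : s) => e t (X α ω)) M) :
    ∃ L : Measure D, IsTightMeasureSet {L} ∧ ConvergesWeakly P X L := by
  choose I hI hIneg using h.exists_tendsto_outerExpectation he hsep hmarg
  have hadd_le : ∀ (f g k : D →ᵇ ℝ) (a b c : ℝ),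
      Tendsto (fun α => outerExpectation (P α) (fun ω => f (X α ω))) atTop (𝓝 a) →
      Tendsto (fun α => outerExpectation (P α) (fun ω => g (X α ω))) atTop (𝓝 b) →
      Tendsto (fun α => outerExpectation (P α) (fun ω => k (X α ω))) atTop (𝓝 c) →
      k = f + g → c ≤ a + b := by
    rintro f g k a b c ha hb hc rfl
    exact le_of_tendsto_of_tendsto' hc (ha.add hb) fun α =>
      outerExpectation_add_le (f.exists_abs_comp_le (X α)) (g.exists_abs_comp_le (X α))
  have hsmul_le : ∀ (f k : D →ᵇ ℝ) (a b r : ℝ), 0 < r →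
      Tendsto (fun α => outerExpectation (P α) (fun ω => f (X α ω))) atTop (𝓝 a) →
      Tendsto (fun α => outerExpectation (P α) (fun ω => k (X α ω))) atTop (𝓝 b) →
      k = r • f → b ≤ r * a := by
    rintro f k a b r hr ha hb rfl
    exact le_of_tendsto_of_tendsto' hb (ha.const_mul r) fun α =>
      outerExpectation_const_mul_le (f.exists_abs_comp_le (X α)) hr
  have hneg : ∀ f : D →ᵇ ℝ,
      Tendsto (fun α => outerExpectation (P α) (fun ω => (-f) (X α ω))) atTop (𝓝 (-I f)) := hIneg
  have hconst : ∀ c : ℝ, I (.const D c) = c := fun c =>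
    tendsto_nhds_unique (hI (.const D c)) (by
      simp only [BoundedContinuousFunction.const_apply, outerExpectation_const]
      exact tendsto_const_nhds)
  -- subadditivity for `f, g` and for `-f, -g` gives both inequalities, likewise for scalars
  let J : (D →ᵇ ℝ) →ₗ[ℝ] ℝ :=
    { toFun := I
      map_add' := fun f g => le_antisymm (hadd_le f g _ _ _ _ (hI f) (hI g) (hI _) rfl) (by
        have := hadd_le _ _ _ _ _ _ (hneg f) (hneg g) (hneg (f + g)) (neg_add f g)
        linarith)
      map_smul' := fun r f => by
        rw [RingHom.id_apply, smul_eq_mul]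
        rcases lt_trichotomy r 0 with hr | rfl | hr
        · have h1 := hsmul_le _ _ _ _ (-r) (neg_pos.2 hr) (hneg f) (hI (r • f))
            (neg_smul_neg r f).symm
          have h2 := hsmul_le _ _ _ _ (-r) (neg_pos.2 hr) (hI f) (hneg (r • f))
            (neg_smul r f).symm
          linarith
        · rw [zero_smul, zero_mul]
          exact hconst 0
        · have h1 := hsmul_le _ _ _ _ r hr (hI f) (hI (r • f)) rfl
          have h2 := hsmul_le _ _ _ _ r hr (hneg f) (hneg (r • f)) (smul_neg r f).symm
          linarith }
  have hpos : ∀ f : D →ᵇ ℝ, (∀ x, 0 ≤ f x) → 0 ≤ J f := fun f hf => by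
    refine ge_of_tendsto' (hI f) fun α => ?_
    rw [← outerExpectation_const (P := P α) 0]
    exact outerExpectation_mono ⟨0, fun _ => by simp⟩ (f.exists_abs_comp_le (X α))
      fun ω => hf (X α ω)
  have htight : ∀ ε : ℝ, 0 < ε → ∃ K : Set D, IsCompact K ∧
      ∀ f : D →ᵇ ℝ, (∀ x, 0 ≤ f x) → (∀ x ∈ K, 1 ≤ f x) → 1 - ε ≤ J f := fun ε hε => by
    obtain ⟨K, hK, hKle⟩ := h.exists_isCompact_eventually_le (half_pos hε)
    refine ⟨K, hK, fun f hf hfK => ge_of_tendsto (hI f) ?_⟩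
    refine (hKle (.const D 1) f (ε / 2) 1 (by positivity) zero_le_one (fun x hx => ?_)
      fun x => ?_).mono fun α hα => ?_
    · have := hfK x hx
      simp only [BoundedContinuousFunction.const_apply]
      linarith
    · simpa using hf x
    · simp only [BoundedContinuousFunction.const_apply, outerExpectation_const] at hα
      linarith
  obtain ⟨L, hLP, hLt, hL⟩ :=
    exists_tight_measure_of_tight_functional J hpos (hconst 1) htight
  exact ⟨L, hLt, hLP, fun f => by rw [hL f]; exact hI f⟩

/-- The continuous mapping theorem for nets of arbitrary maps. -/
lemma ConvergesWeakly.comp_continuous {E : Type*} [TopologicalSpace E] [MeasurableSpace E]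
    [BorelSpace E] {L : Measure D} (h : ConvergesWeakly P X L) {g : D → E} (hg : Continuous g) :
    ConvergesWeakly P (fun α ω => g (X α ω)) (L.map g) := by
  have := h.1
  refine ⟨Measure.isProbabilityMeasure_map hg.measurable.aemeasurable, fun f => ?_⟩
  rw [integral_map hg.measurable.aemeasurable f.continuous.measurable.aestronglyMeasurable]
  exact h.2 (f.compContinuous ⟨g, hg⟩)

/-- A net that converges weakly to a tight limit is asymptotically tight. -/
lemma ConvergesWeakly.asymptoticallyTight [IsDirectedOrder A] [Nonempty A]
    [∀ α, IsProbabilityMeasure (P α)] {L : Measure D} (h : ConvergesWeakly P X L)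
    (hL : IsTightMeasureSet {L}) : AsymptoticallyTight P X := by
  intro ε hε
  have := h.1
  obtain ⟨K, hK, hKL⟩ := isTightMeasureSet_iff_exists_isCompact_measure_compl_le.1 hL ε hε
  refine ⟨K, hK, fun δ hδ => ?_⟩
  let f : D →ᵇ ℝ := .ofNormedAddCommGroup (fun x => (thickenedIndicator hδ K x : ℝ))
    (by fun_prop) 1 fun x => by simpa using thickenedIndicator_le_one hδ K x
  have hf1 : ∀ x, f x ≤ 1 := fun x => thickenedIndicator_le_one hδ K x
  have hf0 : ∀ x, 0 ≤ f x := fun x => NNReal.coe_nonneg _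
  have hlim := (h.2 (-f)).neg
  simp only [BoundedContinuousFunction.coe_neg, Pi.neg_apply, integral_neg, neg_neg] at hlim
  calc 1 - ε ≤ L K := by
        rw [tsub_le_iff_right, ← prob_add_prob_compl (μ := L) hK.measurableSet]
        gcongr
        exact hKL L rfl
    _ ≤ ENNReal.ofReal (∫ x, f x ∂L) := by
        rw [ENNReal.le_ofReal_iff_toReal_le (measure_ne_top _ _) (integral_nonneg hf0)]
        have h1 : ∫ x, K.indicator (fun _ => (1 : ℝ)) x ∂L ≤ ∫ x, f x ∂L := by
          refine integral_mono ((integrable_const _).indicator hK.measurableSet)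
            (f.integrable L) fun x => ?_
          by_cases hx : x ∈ K
          · simpa [hx, f] using one_le_thickenedIndicator_apply D hδ hx
          · simpa [hx] using hf0 x
        simpa [integral_indicator_const _ hK.measurableSet, measureReal_def] using h1
    _ = liminf (fun α => ENNReal.ofReal
          (-outerExpectation (P α) (fun ω => -f (X α ω)))) atTop :=
        (ENNReal.tendsto_ofReal hlim).liminf_eq.symm
    _ ≤ _ := liminf_le_liminf (Eventually.of_forall fun α =>
        ofReal_neg_outerExpectation_neg_le_innerProbability (f.exists_abs_comp_le (X α))
          (fun ω => hf1 _) fun ω hω => by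
            change (thickenedIndicator hδ K (X α ω) : ℝ) ≤ 0
            rw [thickenedIndicator_zero hδ K hω, NNReal.coe_zero])

/-- Weak limits are unique. -/
lemma ConvergesWeakly.unique [IsDirectedOrder A] [Nonempty A] {E : Type*} [TopologicalSpace E]
    [MeasurableSpace E] [BorelSpace E] [HasOuterApproxClosed E] {Z : ∀ α, Ω α → E}
    {L M : Measure E} (hL : ConvergesWeakly P Z L) (hM : ConvergesWeakly P Z M) : L = M := by
  have := hL.1
  have := hM.1
  exact ext_of_forall_integral_eq_of_IsFiniteMeasure fun f =>
    tendsto_nhds_unique (hL.2 f) (hM.2 f)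

end Limits

/-! ### Versions of a process -/

/-- A process whose finite-dimensional distributions agree with those of a tight measure `L` has a
Borel measurable version with law `L`: countably many coordinates determine the points of a
σ-compact set carrying `L`, and the version is a measurable function of these coordinates of the
process. -/
theorem exists_version_of_tight {D ι : Type*} [MetricSpace D] [MeasurableSpace D]
    [BorelSpace D] {e : ι → D → ℝ} (he : ∀ t, Continuous (e t))
    (hsep : ∀ x y, (∀ t, e t x = e t y) → x = y) {L : Measure D} [IsProbabilityMeasure L]
    (hL : IsTightMeasureSet {L}) {Ω' : Type*} [MeasurableSpace Ω'] {P' : Measure Ω'}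
    [IsProbabilityMeasure P'] {Y : ι → Ω' → ℝ} (hY : ∀ t, Measurable (Y t))
    (hfd : ∀ s : Finset ι,
      P'.map (fun ω (t : s) => Y t ω) = L.map (fun x (t : s) => e t x)) :
    ∃ Y' : Ω' → D, Measurable Y' ∧ (∀ t, ∀ᵐ ω ∂P', e t (Y' ω) = Y t ω) ∧ P'.map Y' = L := by
  have hne : Nonempty D := nonempty_of_isProbabilityMeasure L
  have hem : Measurable fun x t => e t x := measurable_pi_lambda _ fun t => (he t).measurable
  have hYm : Measurable fun ω t => Y t ω := measurable_pi_lambda _ hY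
  have hlaw : P'.map (fun ω t => Y t ω) = L.map (fun x t => e t x) := by
    have h1 : IsProjectiveLimit (P'.map fun ω t => Y t ω)
        fun s : Finset ι => L.map fun x (t : s) => e t x := fun s => by
      rw [Measure.map_map (by fun_prop) hYm]
      exact hfd s
    have h2 : IsProjectiveLimit (L.map fun x t => e t x)
        fun s : Finset ι => L.map fun x (t : s) => e t x := fun s => by
      rw [Measure.map_map (by fun_prop) hem]
      rfl
    exact h1.unique h2
  have hcompact : ∀ n : ℕ, ∃ K : Set D, IsCompact K ∧ L Kᶜ ≤ ((n : ℝ≥0∞) + 1)⁻¹ := fun n => by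
    obtain ⟨K, hK, h⟩ := isTightMeasureSet_iff_exists_isCompact_measure_compl_le.1 hL
      ((n : ℝ≥0∞) + 1)⁻¹ (by simp)
    exact ⟨K, hK, h L rfl⟩
  choose K hK hKL using hcompact
  have hS : ∀ᵐ x ∂L, x ∈ ⋃ n, K n := by
    have hlim : Tendsto (fun n : ℕ => ((n : ℝ≥0∞) + 1)⁻¹) atTop (𝓝 0) := by
      simpa using (tendsto_add_atTop_iff_nat 1).2 ENNReal.tendsto_inv_nat_nhds_zero
    refine le_antisymm (ge_of_tendsto' hlim fun n => (measure_mono ?_).trans (hKL n)) zero_le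
    exact Set.compl_subset_compl.2 (Set.subset_iUnion K n)
  obtain ⟨J, hJ, hinj⟩ := exists_countable_injOn_iUnion_isCompact he hsep hK
  have : Countable J := hJ.to_subtype
  obtain ⟨r, hr, hre⟩ := exists_measurable_leftInvOn hK (π := fun x (t : J) => e t x)
    (by fun_prop) hinj
  -- the reconstruction of a point from all its coordinates, which uses only those in `J`
  let R : (ι → ℝ) → D := fun z => r fun t : J => z t
  have hR : Measurable R := hr.comp (by fun_prop)
  have hRe : ∀ᵐ x ∂L, R (fun t => e t x) = x := hS.mono fun x hx => hre hx
  refine ⟨fun ω => R fun t => Y t ω, hR.comp hYm, fun t => ?_, ?_⟩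
  · have hm : MeasurableSet {z : ι → ℝ | e t (R z) = z t} :=
      measurableSet_eq_fun ((he t).measurable.comp hR) (measurable_pi_apply t)
    have h1 : ∀ᵐ z ∂L.map (fun x t => e t x), e t (R z) = z t :=
      (ae_map_iff hem.aemeasurable hm).2 (hRe.mono fun x hx => congrArg (e t) hx)
    rw [← hlaw] at h1
    exact (ae_map_iff hYm.aemeasurable hm).1 h1
  · change P'.map (R ∘ fun ω t => Y t ω) = L
    rw [← Measure.map_map hR hYm, hlaw, Measure.map_map hR hem]
    exact (Measure.map_congr hRe).trans Measure.map_id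

/-! ### The space of bounded integrable functions -/

lemma BddIntegrable.continuous_eval {T : Type*} [MeasurableSpace T]
    {μ : SigmaFiniteSignedMeasure T} (t : T) : Continuous fun z : BddIntegrable μ => z t := by
  refine LipschitzWith.continuous (K := 1) (LipschitzWith.of_dist_le_mul fun x y => ?_)
  change |x t - y t| ≤ 1 * dist x y
  rw [one_mul, dist_eq_norm x y]
  exact (abs_le_supNorm (x - y) t).trans (le_max_left _ _)

theorem mainTheorem7
    {T : Type*} [MeasurableSpace T] (μ : SigmaFiniteSignedMeasure T)
    {A : Type*} [Preorder A] [IsDirectedOrder A] [Nonempty A]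
    {Ω : A → Type*} [∀ α, MeasurableSpace (Ω α)]
    (P : ∀ α, Measure (Ω α)) [∀ α, IsProbabilityMeasure (P α)]
    (X : ∀ α, Ω α → BddIntegrable μ) :
    ((∃ L : Measure (BddIntegrable μ), IsTightMeasureSet {L} ∧ ConvergesWeakly P X L) ↔
      (AsymptoticallyTight P X ∧
        ∀ s : Finset T, ∃ M : Measure (s → ℝ),
          ConvergesWeakly P (fun α ω (t : s) => X α ω t) M)) ∧
    (∀ (Ω' : Type*) [MeasurableSpace Ω'] (P' : Measure Ω') [IsProbabilityMeasure P']
      (Y : T → Ω' → ℝ), (∀ t, Measurable (Y t)) →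
      AsymptoticallyTight P X →
      (∀ s : Finset T, ConvergesWeakly P (fun α ω (t : s) => X α ω t)
        (P'.map (fun ω (t : s) => Y t ω))) →
      ∃ Y' : Ω' → BddIntegrable μ,
        Measurable Y' ∧
        (∀ t, ∀ᵐ ω ∂P', Y' ω t = Y t ω) ∧
        IsTightMeasureSet {P'.map Y'} ∧
        ConvergesWeakly P X (P'.map Y')) := by
  let e : T → BddIntegrable μ → ℝ := fun t z => z t
  have he : ∀ t, Continuous (e t) := BddIntegrable.continuous_eval
  have hsep : ∀ x y, (∀ t, e t x = e t y) → x = y := fun x y hxy => Subtype.ext (funext hxy)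
  have hmap : ∀ L : Measure (BddIntegrable μ), ConvergesWeakly P X L → ∀ s : Finset T,
      ConvergesWeakly P (fun α ω (t : s) => X α ω t) (L.map fun x (t : s) => e t x) :=
    fun L hL s => hL.comp_continuous (g := fun x (t : s) => e t x) (continuous_pi fun t => he t)
  refine ⟨⟨?_, ?_⟩, ?_⟩
  · rintro ⟨L, hLt, hL⟩
    exact ⟨hL.asymptoticallyTight hLt, fun s => ⟨_, hmap L hL s⟩⟩
  · rintro ⟨hX, hmarg⟩
    exact hX.exists_convergesWeakly he hsep hmarg
  · intro Ω' _ P' _ Y hY hX hmarg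
    obtain ⟨L, hLt, hL⟩ := hX.exists_convergesWeakly he hsep fun s => ⟨_, hmarg s⟩
    have := hL.1
    have hfd : ∀ s : Finset T,
        P'.map (fun ω (t : s) => Y t ω) = L.map (fun x (t : s) => e t x) :=
      fun s => (hmarg s).unique (hmap L hL s)
    obtain ⟨Y', hY', hYY', hlaw⟩ := exists_version_of_tight he hsep hLt hY hfd
    exact ⟨Y', hY', hYY', by rwa [hlaw], by rwa [hlaw]⟩
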